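/- Theorem. Let $d\ge 2$. There exists a $\mathbb{Z}^d$-subshift of finite type $Y$ such that the problem "$Y\subseteq X$", whose input is an effective $\mathbb{Z}^d$-subshift $X$, is $\Pi^0_2$-complete. Here alphabets are finite subsets of $\mathbb{N}$. For a finite alphabet $A$ and a set $\mathcal F$ of patterns (maps from a finite subset of $\mathbb{Z}^d$ to $A$), $X_{A,\mathcal F}$ is the set of configurations $x\in A^{\mathbb{Z}^d}$ in which no pattern of $\mathcal F$ occurs at any position. A subshift is of finite type if it equals $X_{A,\mathcal F}$ for some finite alphabet $A$ and finite $\mathcal F$, and effective if it equals $X_{A,\mathcal F}$ for some finite alphabet $A$ and recursively enumerable $\mathcal F$. An effective subshift is given as input by its alphabet $A$ and a program that semi-decides $\mathcal F$; the question is whether $Y\subseteq X_{A,\mathcal F}$ as subsets of $\mathbb{N}^{\mathbb{Z}^d}$. A problem is $\Pi^0_2$-complete if it can be written as $\forall m\,\exists n\,R(\text{input},m,n)$ with $R$ decidable and every $\Pi^0_2$ subset of $\mathbb{N}$ is many-one reducible to it. -/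

import Mathlib

open SymbolicDynamics.FullShift

/-- The grid `ℤ^d`. -/
abbrev Grid (d : ℕ) : Type := Fin d → ℤ

/-- The subshift `X_F` of `A^(ℤ^d)`, for a finite alphabet `A ⊆ ℕ` and a set `F` of forbidden
patterns: the configurations with letters in `A` in which no pattern of `F` occurs.
(A pattern of `F` using a letter outside `A` never occurs in such a configuration, so it imposes no
constraint.) -/
def subshiftOn {d : ℕ} (A : Finset ℕ) (F : Set (Pattern ℕ (Grid d))) : Subshift ℕ (Grid d) where
  carrier := {x | ∀ u, x u ∈ A} ∩ forbidden F
  isClosed := by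
    refine IsClosed.inter ?_ (isClosed_forbidden F)
    have h : {x : Grid d → ℕ | ∀ u, x u ∈ A} = ⋂ u, (fun x => x u) ⁻¹' (A : Set ℕ) := by
      ext x; simp
    rw [h]
    exact isClosed_iInter fun u => (isClosed_discrete _).preimage (continuous_apply u)
  mapsTo := fun g _ hx => ⟨fun u => hx.1 (g + u), Pattern.mapsTo_shift_forbidden F g hx.2⟩

/-- `Y` is a subshift of finite type: it is defined, over a finite alphabet, by a finite set of
forbidden patterns. -/
def IsSFT {d : ℕ} (Y : Subshift ℕ (Grid d)) : Prop :=
  ∃ (A : Finset ℕ) (F : Set (Pattern ℕ (Grid d))), F.Finite ∧ Y = subshiftOn A F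

/-- The pattern described by a finite list of pairs (cell, letter). Its support is the set of cells
listed; if a cell is listed several times, its first entry counts. -/
def patternOfList {d : ℕ} (l : List (Grid d × ℕ)) : Pattern ℕ (Grid d) where
  config := fun g => (l.lookup g).getD 0
  support := (l.map Prod.fst).toFinset
  condition := by
    intro g hg
    have h : l.lookup g = none := by
      rw [List.lookup_eq_none_iff]
      intro p hp
      simp only [List.mem_toFinset, List.mem_map, not_exists, not_and] at hg
      simpa using fun h : g = p.1 => hg p hp h.symm
    simp [h]

/-- Every pattern is described by some list. -/
theorem patternOfList_surjective {d : ℕ} :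
    Function.Surjective (patternOfList : List (Grid d × ℕ) → Pattern ℕ (Grid d)) := by
  rintro ⟨c, S, hc⟩
  have key : ∀ (L : List (Grid d)) (g : Grid d),
      (L.map fun h => (h, c h)).lookup g = if g ∈ L then some (c g) else none := by
    intro L g
    induction L with
    | nil => simp
    | cons a L ih =>
      by_cases h : g = a
      · subst h; simp
      · have h' : (g == a) = false := by simpa using h
        simp [List.lookup_cons, ih, h, h']
  refine ⟨S.toList.map fun g => (g, c g), ?_⟩
  unfold patternOfList
  congr 1
  · funext g
    rw [key]
    by_cases h : g ∈ S
    · simp [h]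
    · simpa [h] using (hc g h).symm
  · ext g; simp

/-- The `Σ⁰₁` set of patterns presented by a program `c`: the patterns having a description on which
`c` halts. -/
def patternsOfCode {d : ℕ} (c : Nat.Partrec.Code) : Set (Pattern ℕ (Grid d)) :=
  patternOfList '' {l | (c.eval (@Encodable.encode _ Primcodable.toEncodable l)).Dom}

/-- The effective subshift presented by an input `i`, which consists of a finite alphabet (given as
the list of its letters) and a program for a `Σ⁰₁` set of forbidden patterns. -/
def effectiveSubshift (d : ℕ) (i : List ℕ × Nat.Partrec.Code) : Subshift ℕ (Grid d) :=
  subshiftOn i.1.toFinset (patternsOfCode i.2)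

/-- `P` is a `Π⁰₂` predicate: `P a ↔ ∀ m, ∃ n, R (a, m, n)` for a decidable relation `R`. -/
def IsPi02 {α : Type*} [Primcodable α] (P : α → Prop) : Prop :=
  ∃ R : α × ℕ × ℕ → Prop, ComputablePred R ∧ ∀ a, P a ↔ ∀ m, ∃ n, R (a, m, n)

/-- `P` is `Π⁰₂`-hard: every `Π⁰₂` set of natural numbers is many-one reducible to `P`. -/
def IsPi02Hard {α : Type*} [Primcodable α] (P : α → Prop) : Prop :=
  ∀ Q : ℕ → Prop, IsPi02 Q → ManyOneReducible Q P

/-- `P` is `Π⁰₂`-complete. -/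
def IsPi02Complete {α : Type*} [Primcodable α] (P : α → Prop) : Prop :=
  IsPi02 P ∧ IsPi02Hard P

/-! ### Primitive recursive functions on integers, grids and words -/

/-! Upper bound. As `Y` is shift-invariant, `Y ⊆ X` fails only if a letter of `Y` is missing from
the alphabet of `X`, or a forbidden pattern of `X` is shown at the origin by some configuration of
`Y` (`subset_effectiveSubshift_iff`). For `Y` given by a local rule, compactness turns "no
configuration of `Y` shows `l`" into a `Σ⁰₁` condition: some finite set of cells admits no filling
consistent with the rule and with `l` (`exists_obeys_iff`). Inclusion then says that for every
halting computation accepting a pattern there is such a finite refutation, which is a `∀∃`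
statement.

Hardness. `Y` is given by the local rule of space-time diagrams of a machine computing a universal
partial recursive function, where halting is forbidden. The pattern `P n` is a row segment holding
the input `n` between two end marks. The marks force the rest of the row to be blank, so the whole
computation above it is forced; hence `P n` appears in `Y` iff the machine runs forever on `n`
(`not_dom_of_diagramRule`, `exists_diagram_of_not_dom`). A `Π⁰₂` set has the form `{a | ∀ m, c halts
on (a, m)}` (`IsPi02.exists_code`). Send `a` to the effective subshift forbidding the patterns
attached to `(c, (a, m))` for all `m`: it contains `Y` iff none of them appears in `Y`, that is, iff
all these computations halt. -/

theorem Primrec.int_natCast : Primrec (fun n : ℕ => (n : ℤ)) :=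
  Primrec.encode_iff.1 (Primrec.nat_double.of_eq fun _ => rfl)

theorem Primrec.int_add_one : Primrec (fun z : ℤ => z + 1) := by
  refine Primrec.encode_iff.1 ?_
  -- The code of `n ≥ 0` is `2n` and that of `-(n+1)` is `2n+1`; the code `1` stands for `-1`, whose
  -- successor has code `0`.
  have h : Primrec fun n : ℕ => if n % 2 = 0 then n + 2 else if n = 1 then 0 else n - 2 :=
    Primrec.ite (Primrec.eq.comp (Primrec.nat_mod.comp Primrec.id (Primrec.const 2))
        (Primrec.const 0))
      (Primrec.nat_add.comp Primrec.id (Primrec.const 2))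
      (Primrec.ite (Primrec.eq.comp Primrec.id (Primrec.const 1)) (Primrec.const 0)
        (Primrec.nat_sub.comp Primrec.id (Primrec.const 2)))
  refine (h.comp (Primrec.encode (α := ℤ))).of_eq fun z => ?_
  rcases z with n | n
  · change (if (2 * n) % 2 = 0 then 2 * n + 2 else _) = 2 * (n + 1)
    rw [if_pos (by omega)]; ring
  · change (if (2 * n + 1) % 2 = 0 then _ else if 2 * n + 1 = 1 then 0 else 2 * n + 1 - 2) = _
    rw [if_neg (by omega)]
    rcases n with _ | n
    · rfl
    · change _ = 2 * n + 1
      rw [if_neg (by omega)]; omega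

/-- The unit vector of the grid in direction `k`. -/
def unitVec {d : ℕ} (k : Fin d) : Grid d := Pi.single k 1

theorem Primrec.add_unitVec {d : ℕ} (k : Fin d) : Primrec fun u : Grid d => u + unitVec k := by
  refine Primrec.fin_curry.2 (Primrec₂.swap (Primrec.fin_curry₁.2 fun i => ?_))
  have hi : Primrec fun u : Grid d => u i := Primrec.fin_app.comp Primrec.id (Primrec.const i)
  by_cases h : i = k
  · subst h
    exact (Primrec.int_add_one.comp hi).of_eq fun u => by simp [unitVec]
  · exact hi.of_eq fun u => by simp [unitVec, h]

theorem Primrec.natCast_mul_unitVec {d : ℕ} (k : Fin d) :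
    Primrec fun n : ℕ => (Pi.single k (n : ℤ) : Grid d) := by
  refine Primrec.fin_curry.2 (Primrec₂.swap (Primrec.fin_curry₁.2 fun i => ?_))
  by_cases h : i = k
  · subst h
    exact Primrec.int_natCast.of_eq fun u => by simp
  · exact (Primrec.const 0).of_eq fun u => by simp [h]

/-- The words of length `n` over `Fin N`. -/
def wordsOfLength (N : ℕ) : ℕ → List (List (Fin N))
  | 0 => [[]]
  | n + 1 => (wordsOfLength N n).flatMap fun w => (List.finRange N).map fun a => a :: w

theorem mem_wordsOfLength {N n : ℕ} {w : List (Fin N)} :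
    w ∈ wordsOfLength N n ↔ w.length = n := by
  induction n generalizing w with
  | zero => simp [wordsOfLength]
  | succ n ih =>
    cases w with
    | nil => simp [wordsOfLength]
    | cons a w => simp [wordsOfLength, ih]

theorem Primrec.wordsOfLength (N : ℕ) : Primrec (wordsOfLength N) := by
  have h : Primrec fun L : List (List (Fin N)) =>
      L.flatMap fun w => (List.finRange N).map fun a => a :: w :=
    Primrec.list_flatMap Primrec.id (Primrec.list_map (Primrec.const _)
      (Primrec.list_cons.comp Primrec.snd (Primrec.snd.comp Primrec.fst)).to₂).to₂
  refine (Primrec.nat_rec₁ [[]] (h.comp Primrec.snd).to₂).of_eq fun n => ?_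
  induction n with
  | zero => rfl
  | succ n ih => simp only [_root_.wordsOfLength, ← ih]

/-! ### Subshifts given by a local rule on four cells -/

/-- The pattern of four cells `0`, `e`, `2e`, `e + e'` with the letters `q`. -/
def tile {d : ℕ} (k k' : Fin d) (q : ℕ × ℕ × ℕ × ℕ) : List (Grid d × ℕ) :=
  [(0, q.1), (unitVec k, q.2.1), (unitVec k + unitVec k, q.2.2.1), (unitVec k + unitVec k', q.2.2.2)]

/-- The subshift of the configurations with letters `< N`, whose letters at the cells `u`, `u + e`,
`u + 2e`, `u + e + e'` are related by `ok`, for all `u`. -/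
def ruleShift {d : ℕ} (k k' : Fin d) {N : ℕ} (ok : Fin N → Fin N → Fin N → Fin N → Prop) :
    Subshift ℕ (Grid d) :=
  subshiftOn (Finset.range N) (Set.range fun q : {q : Fin N × Fin N × Fin N × Fin N //
    ¬ ok q.1 q.2.1 q.2.2.1 q.2.2.2} =>
      patternOfList (tile k k' (q.1.1, q.1.2.1, q.1.2.2.1, q.1.2.2.2)))

theorem isSFT_ruleShift {d : ℕ} (k k' : Fin d) {N : ℕ}
    (ok : Fin N → Fin N → Fin N → Fin N → Prop) : IsSFT (ruleShift k k' ok) :=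
  ⟨_, _, Set.finite_range _, rfl⟩

/-- The configuration `y` obeys the rule `ok`. -/
def Obeys {d : ℕ} (k k' : Fin d) {A : Type*} (ok : A → A → A → A → Prop) (y : Grid d → A) : Prop :=
  ∀ u, ok (y u) (y (u + unitVec k)) (y (u + unitVec k + unitVec k)) (y (u + unitVec k + unitVec k'))

/-- A listed cell always has a lookup value, so the default letter `0` of `patternOfList` plays no
role. -/
theorem occursInAt_patternOfList {d : ℕ} (l : List (Grid d × ℕ)) (x : Grid d → ℕ) (g : Grid d) :
    (patternOfList l).occursInAt x g ↔ ∀ p ∈ l, some (x (g + p.1)) = l.lookup p.1 := by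
  have key : ∀ p ∈ l, ∃ b, l.lookup p.1 = some b := by
    intro p hp
    by_contra! h
    have : l.lookup p.1 = none := by
      cases h' : l.lookup p.1 with
      | none => rfl
      | some b => exact absurd h' (h b)
    rw [List.lookup_eq_none_iff] at this
    simpa using this p hp
  simp only [Pattern.occursInAt, patternOfList, List.mem_toFinset, List.mem_map]
  constructor
  · intro h p hp
    obtain ⟨b, hb⟩ := key p hp
    rw [h p.1 ⟨p, hp, rfl⟩, hb]; rfl
  · rintro h _ ⟨p, hp, rfl⟩
    rw [← h p hp]; rfl

/-- The four cells are pairwise distinct because `k ≠ k'`, so no entry of the list shadows another.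
-/
theorem occursInAt_tile {d : ℕ} {k k' : Fin d} (hk : k ≠ k') (q : ℕ × ℕ × ℕ × ℕ)
    (x : Grid d → ℕ) (g : Grid d) :
    (patternOfList (tile k k' q)).occursInAt x g ↔
      x g = q.1 ∧ x (g + unitVec k) = q.2.1 ∧ x (g + unitVec k + unitVec k) = q.2.2.1 ∧
        x (g + unitVec k + unitVec k') = q.2.2.2 := by
  have h1 : (unitVec k : Grid d) ≠ 0 := fun h => by simpa [unitVec] using congrFun h k
  have h2 : (unitVec k + unitVec k : Grid d) ≠ 0 := fun h => by
    simpa [unitVec] using congrFun h k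
  have h3 : (unitVec k + unitVec k' : Grid d) ≠ 0 := fun h => by
    simpa [unitVec, hk] using congrFun h k
  have h4 : (unitVec k + unitVec k : Grid d) ≠ unitVec k + unitVec k' := fun h => by
    simpa [unitVec, hk] using congrFun h k
  have h5 : (unitVec k + unitVec k : Grid d) ≠ unitVec k := by simpa using h1
  have h6 : (unitVec k + unitVec k' : Grid d) ≠ unitVec k := fun h => by
    simpa [unitVec] using congrFun h k'
  rw [occursInAt_patternOfList]
  have e : ∀ a b : Grid d, a ≠ b → (a == b) = false := fun a b h => by simpa using h
  simp [tile, List.lookup_cons, e _ _ h1, e _ _ h2, e _ _ h3, e _ _ h4.symm, e _ _ h5, e _ _ h6,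
    add_assoc]

theorem mem_ruleShift {d : ℕ} {k k' : Fin d} (hk : k ≠ k') {N : ℕ}
    {ok : Fin N → Fin N → Fin N → Fin N → Prop} {x : Grid d → ℕ} :
    x ∈ (ruleShift k k' ok).carrier ↔ ∃ y : Grid d → Fin N, (∀ u, x u = y u) ∧ Obeys k k' ok y := by
  constructor
  · rintro ⟨h1, h2⟩
    refine ⟨fun u => ⟨x u, Finset.mem_range.1 (h1 u)⟩, fun _ => rfl, fun u => ?_⟩
    by_contra h
    exact h2 _ ⟨⟨(_, _, _, _), h⟩, rfl⟩ u ((occursInAt_tile hk _ _ _).2 ⟨rfl, rfl, rfl, rfl⟩)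
  · rintro ⟨y, hy, h⟩
    refine ⟨fun u => by simp [hy], ?_⟩
    rintro _ ⟨⟨q, hq⟩, rfl⟩ g ho
    obtain ⟨a, b, c, d⟩ := (occursInAt_tile hk _ _ _).1 ho
    simp only [hy, Fin.val_inj] at a b c d
    apply hq
    rw [← a, ← b, ← c, ← d]
    exact h g

/-- An occurrence at `g` becomes one at the origin after shifting, and `Y` is stable under shifts.
-/
theorem subset_effectiveSubshift_iff {d : ℕ} (Y : Subshift ℕ (Grid d))
    (i : List ℕ × Nat.Partrec.Code) :
    Y.carrier ⊆ (effectiveSubshift d i).carrier ↔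
      (∀ y ∈ Y.carrier, ∀ u, y u ∈ i.1) ∧ ∀ l : List (Grid d × ℕ),
        (i.2.eval (@Encodable.encode _ Primcodable.toEncodable l)).Dom →
          ∀ y ∈ Y.carrier, ¬ ∀ p ∈ l, some (y p.1) = l.lookup p.1 := by
  constructor
  · intro h
    refine ⟨fun y hy u => by simpa using (h hy).1 u, fun l hl y hy ho => ?_⟩
    refine (h hy).2 _ ⟨l, hl, rfl⟩ 0 ((occursInAt_patternOfList _ _ _).2 ?_)
    simpa using ho
  · rintro ⟨h1, h2⟩ y hy
    refine ⟨fun u => by simpa using h1 y hy u, ?_⟩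
    rintro _ ⟨l, hl, rfl⟩ g ho
    exact h2 l hl _ (Y.mapsTo g hy) ((occursInAt_patternOfList _ _ _).1 ho)

/-! ### The inclusion problem for a rule shift is `Π⁰₂` -/

/-- The rule `ok` holds for the letters that are known. -/
def okKnown {N : ℕ} (ok : Fin N → Fin N → Fin N → Fin N → Prop)
    (q : Option (Fin N) × Option (Fin N) × Option (Fin N) × Option (Fin N)) : Prop :=
  ∀ a ∈ q.1, ∀ b ∈ q.2.1, ∀ c ∈ q.2.2.1, ∀ e ∈ q.2.2.2, ok a b c e

/-- The letter at the cell `u` in a word listing the letters of the cells in the order of their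
codes. -/
def letterAt {d N : ℕ} (w : List (Fin N)) (u : Grid d) : Option (Fin N) :=
  w[@Encodable.encode _ Primcodable.toEncodable u]?

/-- The word `w`, read as a partial configuration, obeys the rule `ok` and shows the pattern `l`. -/
def Consistent {d : ℕ} (k k' : Fin d) {N : ℕ} (ok : Fin N → Fin N → Fin N → Fin N → Prop)
    (w : List (Fin N)) (l : List (Grid d × ℕ)) : Prop :=
  (∀ u ∈ (List.range w.length).filterMap (@Encodable.decode (Grid d) Primcodable.toEncodable),
    okKnown ok (letterAt w u, letterAt w (u + unitVec k), letterAt w (u + unitVec k + unitVec k),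
      letterAt w (u + unitVec k + unitVec k'))) ∧
  ∀ p ∈ l, letterAt w p.1 = none ∨ (letterAt w p.1).map Fin.val = l.lookup p.1

theorem Primrec.letterAt {d N : ℕ} :
    Primrec₂ (letterAt : List (Fin N) → Grid d → Option (Fin N)) :=
  Primrec.list_getElem?.comp Primrec.fst (Primrec.encode.comp Primrec.snd)

theorem primrecRel_consistent {d : ℕ} (k k' : Fin d) {N : ℕ}
    (ok : Fin N → Fin N → Fin N → Fin N → Prop) : PrimrecRel (Consistent k k' ok) := by
  classical
  have ha (k : Fin d) : Primrec fun u : Grid d => u + unitVec k := Primrec.add_unitVec k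
  -- Any predicate on a finite type is primitive recursive, so nothing need be assumed about `ok`.
  have hok : PrimrecPred (okKnown ok) := (Primrec.dom_finite fun q => decide (okKnown ok q)).primrecPred
  have h1 : PrimrecRel fun (u : Grid d) (w : List (Fin N)) =>
      okKnown ok (letterAt w u, letterAt w (u + unitVec k), letterAt w (u + unitVec k + unitVec k),
        letterAt w (u + unitVec k + unitVec k')) := by
    have hl {f : Grid d → Grid d} (hf : Primrec f) :
        Primrec fun p : Grid d × List (Fin N) => _root_.letterAt p.2 (f p.1) :=
      Primrec.letterAt.comp Primrec.snd (hf.comp Primrec.fst)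
    exact hok.comp ((hl Primrec.id).pair ((hl (ha k)).pair ((hl ((ha k).comp (ha k))).pair
      (hl ((ha k').comp (ha k))))))
  have h2 : PrimrecRel fun (p : Grid d × ℕ) (q : List (Fin N) × List (Grid d × ℕ)) =>
      letterAt q.1 p.1 = none ∨ (letterAt q.1 p.1).map Fin.val = q.2.lookup p.1 := by
    have hl : Primrec fun r : (Grid d × ℕ) × (List (Fin N) × List (Grid d × ℕ)) =>
        _root_.letterAt r.2.1 r.1.1 :=
      Primrec.letterAt.comp (Primrec.fst.comp Primrec.snd) (Primrec.fst.comp Primrec.fst)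
    exact (Primrec.eq.comp hl (Primrec.const none)).or
      (Primrec.eq.comp (Primrec.option_map hl (Primrec.fin_val.comp Primrec.snd).to₂)
        (Primrec.listLookup.comp (Primrec.fst.comp Primrec.fst) (Primrec.snd.comp Primrec.snd)))
  have hf : Primrec fun w : List (Fin N) => (List.range w.length).filterMap
      (@Encodable.decode (Grid d) Primcodable.toEncodable) :=
    Primrec.listFilterMap (Primrec.list_range.comp Primrec.list_length)
      (Primrec.decode.comp Primrec.snd).to₂
  exact (h1.forall_mem_list.comp (hf.comp Primrec.fst) Primrec.fst).and
    (h2.forall_mem_list.comp Primrec.snd Primrec.id)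

theorem letterAt_ofFn {d N n : ℕ} (z : ℕ → Fin N) (u : Grid d) :
    letterAt (List.ofFn fun i : Fin n => z i) u =
      if @Encodable.encode _ Primcodable.toEncodable u < n then
        some (z (@Encodable.encode _ Primcodable.toEncodable u)) else none := by
  simp only [letterAt, List.getElem?_ofFn]
  split_ifs <;> rfl

theorem Consistent.of_obeys {d : ℕ} {k k' : Fin d} {N : ℕ}
    {ok : Fin N → Fin N → Fin N → Fin N → Prop} {y : Grid d → Fin N} (hy : Obeys k k' ok y)
    {l : List (Grid d × ℕ)} (hl : ∀ p ∈ l, some (y p.1 : ℕ) = l.lookup p.1) {z : ℕ → Fin N}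
    (hz : ∀ u, z (@Encodable.encode _ Primcodable.toEncodable u) = y u) (n : ℕ) :
    Consistent k k' ok (List.ofFn fun i : Fin n => z i) l := by
  constructor
  · intro u _ a ha b hb c hc e he
    simp only [letterAt_ofFn, Option.mem_def, Option.ite_none_right_eq_some, Option.some.injEq, hz]
      at ha hb hc he
    rw [← ha.2, ← hb.2, ← hc.2, ← he.2]
    exact hy u
  · intro p hp
    rw [letterAt_ofFn]
    split_ifs
    · exact Or.inr (by rw [← hl p hp, hz]; rfl)
    · exact Or.inl rfl

/-- Forgetting letters only removes constraints; this makes the closed sets in the compactness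
argument decreasing. -/
theorem Consistent.of_succ {d : ℕ} {k k' : Fin d} {N : ℕ}
    {ok : Fin N → Fin N → Fin N → Fin N → Prop} {l : List (Grid d × ℕ)} {z : ℕ → Fin N} {n : ℕ}
    (h : Consistent k k' ok (List.ofFn fun i : Fin (n + 1) => z i) l) :
    Consistent k k' ok (List.ofFn fun i : Fin n => z i) l := by
  have mono : ∀ (u : Grid d) (a : Fin N), a ∈ letterAt (List.ofFn fun i : Fin n => z i) u →
      a ∈ letterAt (List.ofFn fun i : Fin (n + 1) => z i) u := by
    intro u a
    simp only [letterAt_ofFn, Option.mem_def, Option.ite_none_right_eq_some]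
    exact fun h => ⟨h.1.trans n.lt_succ_self, h.2⟩
  constructor
  · intro u hu a ha b hb c hc e he
    refine h.1 u ?_ a (mono _ _ ha) b (mono _ _ hb) c (mono _ _ hc) e (mono _ _ he)
    simp only [List.length_ofFn, List.mem_filterMap, List.mem_range] at hu ⊢
    obtain ⟨j, hj, h⟩ := hu
    exact ⟨j, hj.trans n.lt_succ_self, h⟩
  · intro p hp
    cases e : letterAt (List.ofFn fun i : Fin n => z i) p.1 with
    | none => exact Or.inl rfl
    | some a =>
      have := mono _ a e
      rcases h.2 p hp with h | h
      · rw [h] at this; cases this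
      · right; rw [← h, Option.mem_def.1 this]

/-- Each instance of the rule, and each entry of `l`, involves finitely many cells and is seen by
every long enough prefix of `z`. -/
theorem Obeys.of_consistent {d : ℕ} {k k' : Fin d} {N : ℕ}
    {ok : Fin N → Fin N → Fin N → Fin N → Prop} {l : List (Grid d × ℕ)} {z : ℕ → Fin N}
    (h : ∀ n, Consistent k k' ok (List.ofFn fun i : Fin n => z i) l) :
    Obeys k k' ok (fun u => z (@Encodable.encode _ Primcodable.toEncodable u)) ∧
      ∀ p ∈ l, some (z (@Encodable.encode _ Primcodable.toEncodable p.1) : ℕ) = l.lookup p.1 := by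
  have key (u : Grid d) {n : ℕ} (hn : @Encodable.encode _ Primcodable.toEncodable u < n) :
      letterAt (List.ofFn fun i : Fin n => z i) u =
        some (z (@Encodable.encode _ Primcodable.toEncodable u)) := by
    rw [letterAt_ofFn, if_pos hn]
  constructor
  · intro u
    let c (u : Grid d) : ℕ := @Encodable.encode _ Primcodable.toEncodable u
    let n := c u + c (u + unitVec k) + c (u + unitVec k + unitVec k) +
      c (u + unitVec k + unitVec k') + 1
    refine (h n).1 u ?_ _ (key _ ?_) _ (key _ ?_) _ (key _ ?_) _ (key _ ?_)
    · simp only [List.length_ofFn, List.mem_filterMap, List.mem_range]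
      exact ⟨c u, by omega, @Encodable.encodek _ Primcodable.toEncodable u⟩
    all_goals dsimp only [n, c]; omega
  · intro p hp
    have e := key p.1 (Nat.lt_succ_self _)
    rcases (h (@Encodable.encode _ Primcodable.toEncodable p.1 + 1)).2 p hp with h | h
    · rw [e] at h; cases h
    · rw [← h, e]; rfl

/-- Compactness of `ℕ → Fin N`: if every finite prefix length admits a consistent word, the nested
closed sets of consistent sequences have a common point. -/
theorem exists_obeys_iff {d : ℕ} (k k' : Fin d) {N : ℕ}
    (ok : Fin N → Fin N → Fin N → Fin N → Prop) (l : List (Grid d × ℕ)) :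
    (∃ y, Obeys k k' ok y ∧ ∀ p ∈ l, some (y p.1 : ℕ) = l.lookup p.1) ↔
      ∀ n, ∃ w ∈ wordsOfLength N n, Consistent k k' ok w l := by
  constructor
  · rintro ⟨y, hy, hl⟩ n
    -- Numbers that code no cell receive an arbitrary letter.
    let z : ℕ → Fin N := fun j =>
      ((@Encodable.decode (Grid d) Primcodable.toEncodable j).map y).getD (y 0)
    refine ⟨_, mem_wordsOfLength.2 (by simp), Consistent.of_obeys hy hl (z := z) (fun u => ?_) n⟩
    simp [z, @Encodable.encodek _ Primcodable.toEncodable u]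
  · intro h
    have hN : 0 < N := by
      obtain ⟨w, hw, -⟩ := h 1
      rw [mem_wordsOfLength] at hw
      exact (w[0]'(by omega)).pos
    let K (n : ℕ) : Set (ℕ → Fin N) :=
      {z | Consistent k k' ok (List.ofFn fun i : Fin n => z i) l}
    have hK (n : ℕ) : IsClosed (K n) :=
      (isClosed_discrete {v : Fin n → Fin N | Consistent k k' ok (List.ofFn v) l}).preimage
        (f := fun (z : ℕ → Fin N) (i : Fin n) => z i) (by fun_prop)
    obtain ⟨z, hz⟩ := IsCompact.nonempty_iInter_of_sequence_nonempty_isCompact_isClosed K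
      (fun n z hz => Consistent.of_succ hz) (fun n => by
        obtain ⟨w, hw, hc⟩ := h n
        rw [mem_wordsOfLength] at hw
        subst hw
        refine ⟨fun j => w.getD j ⟨0, hN⟩, ?_⟩
        have : (List.ofFn fun i : Fin w.length => w.getD i ⟨0, hN⟩) = w := by
          apply List.ext_getElem <;> simp
        simpa only [K, Set.mem_ofPred_eq, this] using hc) (hK 0).isCompact hK
    rw [Set.mem_iInter] at hz
    exact ⟨_, Obeys.of_consistent hz⟩

/-- The number `m` codes a time bound together with a pattern, and `n` is the length at which no
consistent word remains. -/
theorem isPi02_subset_effectiveSubshift {d : ℕ} {k k' : Fin d} (hk : k ≠ k') {N : ℕ}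
    (ok : Fin N → Fin N → Fin N → Fin N → Prop) :
    IsPi02 fun i : List ℕ × Nat.Partrec.Code =>
      (ruleShift k k' ok).carrier ⊆ (effectiveSubshift d i).carrier := by
  classical
  -- The letters that really occur in `Y`. This list need not be computed: it is a constant,
  -- independent of the input.
  let S : List ℕ := (List.range N).filter fun a => ∃ y ∈ (ruleShift k k' ok).carrier, ∃ u, y u = a
  let code (l : List (Grid d × ℕ)) : ℕ := @Encodable.encode _ Primcodable.toEncodable l
  -- At most one pair; an `m` that decodes to nothing imposes no condition on patterns.
  let dec (m : ℕ) : List (ℕ × List (Grid d × ℕ)) :=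
    (@Encodable.decode (ℕ × List (Grid d × ℕ)) Primcodable.toEncodable m).toList
  refine ⟨fun r => (∀ s ∈ S, ∃ a ∈ r.1.1, a = s) ∧ ∀ q ∈ dec r.2.1,
    Nat.Partrec.Code.evaln q.1 r.1.2 (code q.2) = none ∨
      ∀ w ∈ wordsOfLength N r.2.2, ¬ Consistent k k' ok w q.2, ?_, ?_⟩
  · refine PrimrecPred.computablePred (PrimrecPred.and ?_ ?_)
    · have h1 : PrimrecRel fun (s : ℕ) (A : List ℕ) => ∃ a ∈ A, a = s :=
        (Primrec.eq.exists_mem_list).swap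
      exact h1.forall_mem_list.comp (Primrec.const S) (Primrec.fst.comp Primrec.fst)
    · have h2 : PrimrecRel fun (q : ℕ × List (Grid d × ℕ))
          (r : (List ℕ × Nat.Partrec.Code) × ℕ × ℕ) =>
          Nat.Partrec.Code.evaln q.1 r.1.2 (code q.2) = none ∨
            ∀ w ∈ wordsOfLength N r.2.2, ¬ Consistent k k' ok w q.2 := by
        refine PrimrecPred.or (Primrec.eq.comp (Nat.Partrec.Code.primrec_evaln.comp
          (((Primrec.fst.comp Primrec.fst).pair (Primrec.snd.comp (Primrec.fst.comp Primrec.snd))).pair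
            (Primrec.encode.comp (Primrec.snd.comp Primrec.fst)))) (Primrec.const none)) ?_
        exact ((primrecRel_consistent k k' ok).not.forall_mem_list).comp
          ((Primrec.wordsOfLength N).comp (Primrec.snd.comp (Primrec.snd.comp Primrec.snd)))
          (Primrec.snd.comp Primrec.fst)
      exact h2.forall_mem_list.comp (Primrec.optionToList.comp
        (Primrec.decode.comp (Primrec.fst.comp Primrec.snd))) Primrec.id
  · intro i
    have hS : (∀ y ∈ (ruleShift k k' ok).carrier, ∀ u, y u ∈ i.1) ↔ ∀ s ∈ S, ∃ a ∈ i.1, a = s := by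
      simp only [S, List.mem_filter, List.mem_range, decide_eq_true_eq, exists_eq_right]
      constructor
      · rintro h s ⟨-, y, hy, u, rfl⟩
        exact h y hy u
      · exact fun h y hy u => h _ ⟨Finset.mem_range.1 (hy.1 u), y, hy, u, rfl⟩
    have hl (l : List (Grid d × ℕ)) : (∀ y ∈ (ruleShift k k' ok).carrier,
        ¬ ∀ p ∈ l, some (y p.1) = l.lookup p.1) ↔
          ∃ n, ∀ w ∈ wordsOfLength N n, ¬ Consistent k k' ok w l := by
      have := not_congr (exists_obeys_iff k k' ok l)
      push Not at this
      rw [← this]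
      constructor
      · intro h y hy
        simpa using h _ ((mem_ruleShift hk).2 ⟨y, fun _ => rfl, hy⟩)
      · intro h x hx
        obtain ⟨y, hxy, hy⟩ := (mem_ruleShift hk).1 hx
        simpa [hxy] using h y hy
    refine (subset_effectiveSubshift_iff _ _).trans ?_
    rw [hS]
    simp only [hl]
    constructor
    · rintro ⟨h1, h2⟩ m
      have : ∃ n, ∀ q ∈ dec m, Nat.Partrec.Code.evaln q.1 i.2 (code q.2) = none ∨
          ∀ w ∈ wordsOfLength N n, ¬ Consistent k k' ok w q.2 := by
        simp only [dec, Option.mem_toList]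
        generalize @Encodable.decode (ℕ × List (Grid d × ℕ)) Primcodable.toEncodable m = o
        cases o with
        | none => exact ⟨0, fun q hq => by cases hq⟩
        | some q =>
          simp only [Option.some.injEq, forall_eq']
          cases e : Nat.Partrec.Code.evaln q.1 i.2 (code q.2) with
          | none => exact ⟨0, Or.inl rfl⟩
          | some v =>
            obtain ⟨n, hn⟩ := h2 q.2
              (Part.dom_iff_mem.2 ⟨v, Nat.Partrec.Code.evaln_complete.2 ⟨_, e⟩⟩)
            exact ⟨n, Or.inr hn⟩
      obtain ⟨n, hn⟩ := this
      exact ⟨n, h1, hn⟩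
    · intro h
      refine ⟨(h 0).choose_spec.1, fun l hl => ?_⟩
      obtain ⟨v, hv⟩ := Part.dom_iff_mem.1 hl
      obtain ⟨t, ht⟩ := Nat.Partrec.Code.evaln_complete.1 hv
      obtain ⟨n, -, hn⟩ := h (@Encodable.encode _ Primcodable.toEncodable (t, l))
      refine ⟨n, (hn (t, l) ?_).resolve_left ?_⟩
      · simp only [dec, Option.mem_toList]
        exact @Encodable.encodek _ Primcodable.toEncodable (t, l)
      · intro h'
        rw [Option.mem_def] at ht
        exact absurd (ht.symm.trans h') (by simp)

/-! ### A universal Turing machine with finitely many states -/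

open Turing in
-- The translated machines have infinitely many states, but a run never leaves a supporting set, so
-- the machine can be restricted to it.
theorem exists_tm0_with_finite_states {Γ Λ : Type} [Inhabited Γ] [Inhabited Λ]
    (M : TM0.Machine Γ Λ) {S : Finset Λ} (hS : TM0.Supports M (S : Set Λ)) :
    ∃ (Λ' : Type) (_ : Inhabited Λ') (_ : Finite Λ') (M' : TM0.Machine Γ Λ'),
      ∀ l, (TM0.eval M' l).Dom ↔ (TM0.eval M l).Dom := by
  classical
  let : Inhabited S := ⟨⟨default, hS.1⟩⟩
  let g : Λ → S := fun q => if h : q ∈ S then ⟨q, h⟩ else default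
  have hg : ∀ q ∈ S, ((g q : S) : Λ) = q := fun q hq => by simp [g, hq]
  let g₁ : PointedMap Λ S := ⟨g, by simp only [g, dif_pos (show default ∈ S from hS.1)]; rfl⟩
  let f : PointedMap Γ Γ := ⟨id, rfl⟩
  refine ⟨S, inferInstance, inferInstance, M.map f f g Subtype.val, fun l => ?_⟩
  have := TM0.Machine.map_respects M f f g₁ Subtype.val hS (fun _ => rfl) hg
  have h := StateTransition.tr_eval_dom this (a₁ := TM0.init l) (a₂ := TM0.init l)
    ⟨hS.1, (TM0.map_init f g₁ l).trans (by simp [f])⟩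
  exact h

open Turing PartrecToTM2 in
/-- The tape symbol of the four-stack emulator showing `a` on the input stack. -/
def inputSymbol (a : Γ') : TM2to1.Γ' K' (fun _ => Γ') :=
  (false, Function.update (fun _ => none) K'.main (some a))

open Turing PartrecToTM2 in
/-- The tape symbol at the bottom of the stacks, when the input ends with `Γ'.cons`. -/
def bottomSymbol : TM2to1.Γ' K' (fun _ => Γ') :=
  (true, Function.update (fun _ => none) K'.main (some Γ'.cons))

open Turing PartrecToTM2 in
/-- The tape symbols following the first one, when the number `n` is the input. -/
def inputTail (n : ℕ) : List (TM2to1.Γ' K' (fun _ => Γ')) :=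
  (trNat n).reverse.map inputSymbol

open Turing PartrecToTM2 in
-- The stack is written from its bottom, so the terminator `Γ'.cons` comes first and the first tape
-- symbol does not depend on `n`.
theorem trInit_trList_singleton (n : ℕ) :
    TM2to1.trInit K'.main (trList [n]) = bottomSymbol :: inputTail n := by
  have h : (trList [n]).reverse = Γ'.cons :: (trNat n).reverse := by simp
  unfold TM2to1.trInit
  rw [h]
  rfl

open Turing PartrecToTM2 in
-- Binary recursion on `n / 2`, the form needed to see that the encoding is primitive recursive.
theorem trNat_eq (n : ℕ) : trNat n =
    if n = 0 then [] else (if n % 2 = 0 then Γ'.bit0 else Γ'.bit1) :: trNat (n / 2) := by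
  have h0 : ∀ m : Num, trNum m.bit0 = if m = 0 then [] else Γ'.bit0 :: trNum m := by
    rintro (_ | p)
    · rfl
    · rfl
  have h1 : ∀ m : Num, trNum m.bit1 = Γ'.bit1 :: trNum m := by
    rintro (_ | p)
    · rfl
    · rfl
  rcases Nat.even_or_odd' n with ⟨m, rfl | rfl⟩
  · have : ((2 * m : ℕ) : Num) = (m : Num).bit0 := by
      rw [← Num.bit0_of_bit0]; push_cast; ring
    rw [trNat, this, h0]
    by_cases hm : m = 0
    · simp [hm]
    · have : (m : Num) ≠ 0 := by exact_mod_cast hm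
      simp [hm, this, trNat]
  · have : ((2 * m + 1 : ℕ) : Num) = (m : Num).bit1 := by
      rw [← Num.bit1_of_bit1]; push_cast; ring
    rw [trNat, this, h1]
    have h2 : (2 * m + 1) / 2 = m := by omega
    simp [h2, trNat]

open Turing PartrecToTM2 in
theorem primrec_map_trNat {σ : Type*} [Primcodable σ] (f : Γ' → σ) :
    Primrec fun n => (trNat n).map f := by
  -- Course-of-values recursion: `L` lists the values at all smaller arguments, so its length is the
  -- current argument.
  have hg : Primrec₂ fun (_ : Unit) (L : List (List σ)) =>
      if L.length = 0 then some [] else (L[L.length / 2]?).map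
        (List.cons (if L.length % 2 = 0 then f Γ'.bit0 else f Γ'.bit1)) := by
    have hlen : Primrec fun p : Unit × List (List σ) => p.2.length :=
      Primrec.list_length.comp Primrec.snd
    refine Primrec.ite (Primrec.eq.comp hlen (Primrec.const 0)) (Primrec.const _)
      (Primrec.option_map (Primrec.list_getElem?.comp Primrec.snd
        (Primrec.nat_div.comp hlen (Primrec.const 2))) (Primrec.list_cons.comp₂ ?_ Primrec₂.right))
    exact (Primrec.ite (Primrec.eq.comp (Primrec.nat_mod.comp hlen (Primrec.const 2))
      (Primrec.const 0)) (Primrec.const _) (Primrec.const _)).comp Primrec.fst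
  have := Primrec.nat_strong_rec (fun (_ : Unit) n => (trNat n).map f) hg (fun _ n => by
    by_cases hn : n = 0
    · simp [hn]
    · have : n / 2 < n := by omega
      rw [trNat_eq n]
      simp [hn, this, apply_ite f])
  exact this.comp (Primrec.const ()) Primrec.id

theorem primrec_map_inputTail {σ : Type*} [Primcodable σ]
    (f : Turing.TM2to1.Γ' Turing.PartrecToTM2.K' (fun _ => Turing.PartrecToTM2.Γ') → σ) :
    Primrec fun n => (inputTail n).map f :=
  (Primrec.list_reverse.comp (primrec_map_trNat fun a => f (inputSymbol a))).of_eq fun n => by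
    simp [inputTail, Function.comp_def]

open Turing PartrecToTM2 in
/-- For every partial recursive function there is a Turing machine with finitely many symbols and
states that halts on (an encoding of) `n` if and only if the function is defined at `n`. -/
theorem exists_tm0_of_partrec {f : ℕ →. ℕ} (hf : Partrec f) :
    ∃ (Γ Λ : Type) (_ : Inhabited Γ) (_ : Inhabited Λ) (_ : Finite Γ) (_ : Finite Λ)
      (M : TM0.Machine Γ Λ) (a₀ : Γ) (K : ℕ → List Γ),
      (∀ (k : ℕ) (e : Γ → Fin k), Primrec fun n => (K n).map e) ∧
        ∀ n, (TM0.eval M (a₀ :: K n)).Dom ↔ (f n).Dom := by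
  obtain ⟨c, hc⟩ := ToPartrec.Code.exists_code (Nat.Partrec'.part_iff₁.2 hf)
  -- A machine starts in the default state, so the default is chosen to be the entry point of `c`.
  let : Inhabited Λ' := ⟨trNormal c Cont'.halt⟩
  have hs := TM1to0.tr_supports _ (TM2to1.tr_supports tr (tr_supports c Cont'.halt))
  obtain ⟨Λ, iΛ, fΛ, M, hM⟩ := exists_tm0_with_finite_states _ hs
  have hK : Finite K' := Finite.of_surjective (fun p : Bool × Bool => match p with
    | (true, true) => K'.main
    | (true, false) => K'.rev
    | (false, true) => K'.aux
    | (false, false) => K'.stack) (by rintro (_ | _ | _ | _) <;> simp)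
  have hΓ : Finite (TM2to1.Γ' K' fun _ => Γ') :=
    inferInstanceAs (Finite (Bool × (K' → Option Γ')))
  refine ⟨_, Λ, inferInstance, iΛ, hΓ, fΛ, M, bottomSymbol, inputTail,
    fun k e => primrec_map_inputTail e, fun n => ?_⟩
  rw [← trInit_trList_singleton, hM, TM1to0.tr_eval]
  refine (TM2to1.tr_eval_dom (Γ := fun _ => Γ') tr K'.main (trList [n])).trans ?_
  have hinit : (TM2.init K'.main (trList [n]) : TM2.Cfg (fun _ => Γ') Λ' (Option Γ')) =
      init c [n] := by
    unfold TM2.init PartrecToTM2.init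
    congr 1
    funext k
    cases k <;> rfl
  change (StateTransition.eval (TM2.step tr) (TM2.init K'.main (trList [n]))).Dom ↔ _
  rw [hinit, tr_eval c [n]]
  change (c.eval [n]).Dom ↔ _
  rw [hc ⟨[n], rfl⟩]
  rfl

/-! ### Space-time diagrams of a Turing machine -/

section SpaceTime

open Turing

variable {Γ Λ : Type} [Inhabited Γ] [Inhabited Λ]

/-- The content of the tape cell `i` and the state of the head if it is there, when the head is at
the cell `p` of the tape. -/
def rowOf (p : ℤ) (c : TM0.Cfg Γ Λ) (i : ℤ) : Γ × Option Λ :=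
  (c.Tape.nth (i - p), if i = p then some c.q else none)

/-- What the head does, if it is at the given cell and does not halt. -/
def headAction (M : TM0.Machine Γ Λ) (s : Γ × Option Λ) : Option (Λ × TM0.Stmt Γ) :=
  s.2.bind fun q => M q s.1

/-- The next content of a cell. -/
def nextSymbol (M : TM0.Machine Γ Λ) (s : Γ × Option Λ) : Γ :=
  match headAction M s with
  | some (_, TM0.Stmt.write b) => b
  | _ => s.1

/-- The next state of the head if it leaves the given cell in direction `d`. -/
def leavingState (M : TM0.Machine Γ Λ) (d : Dir) (s : Γ × Option Λ) : Option Λ :=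
  match headAction M s with
  | some (q, TM0.Stmt.move d') => if d' = d then some q else none
  | _ => none

/-- The next state of the head if it stays at the given cell. -/
def stayingState (M : TM0.Machine Γ Λ) (s : Γ × Option Λ) : Option Λ :=
  match headAction M s with
  | some (q, TM0.Stmt.write _) => some q
  | _ => none

/-- The next state of a cell, given the cell and its two neighbours. -/
def nextCell (M : TM0.Machine Γ Λ) (l c r : Γ × Option Λ) : Γ × Option Λ :=
  (nextSymbol M c,
    (leavingState M Dir.right l).or ((stayingState M c).or (leavingState M Dir.left r)))

theorem headAction_rowOf (M : TM0.Machine Γ Λ) (p : ℤ) (c : TM0.Cfg Γ Λ) (i : ℤ) :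
    headAction M (rowOf p c i) = if i = p then M c.q c.Tape.head else none := by
  unfold headAction rowOf
  split_ifs with h
  · simp [h]
  · simp

/-- The tape is indexed relative to the head, whereas a row has absolute coordinates: a move shifts
`p` and re-indexes the tape accordingly, so only the scanned symbol and the head's place can change.
-/
theorem exists_rowOf_eq_nextCell {M : TM0.Machine Γ Λ} {c c' : TM0.Cfg Γ Λ}
    (h : c' ∈ TM0.step M c) (p : ℤ) : ∃ p', ∀ i, rowOf p' c' i =
      nextCell M (rowOf p c (i - 1)) (rowOf p c i) (rowOf p c (i + 1)) := by
  obtain ⟨q, T⟩ := c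
  obtain ⟨⟨q', s⟩, hs, rfl⟩ := Option.map_eq_some_iff.1 h
  have hl : (T.move Dir.left).head = T.nth (-1) := by
    rw [← Tape.nth_zero, Tape.move_left_nth]; rfl
  have hr : (T.move Dir.right).head = T.nth 1 := by
    rw [← Tape.nth_zero, Tape.move_right_nth]; rfl
  have hw (b : Γ) : (T.write b).head = b := rfl
  rcases s with (_ | _) | b
  · refine ⟨p - 1, fun i => ?_⟩
    simp only [nextCell, nextSymbol, leavingState, stayingState, headAction_rowOf, hs]
    rcases eq_or_ne i p with rfl | h0
    · simp [rowOf, show i ≠ i - 1 by omega]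
    · rcases eq_or_ne (i - 1) p with h1 | h1
      · simp [rowOf, h0, h1, show i ≠ p - 1 by omega, show i + 1 ≠ p by omega,
          show i - (p - 1) - 1 = i - p by omega]
      · by_cases h2 : i + 1 = p
        · simp [rowOf, hl, show i = p - 1 by omega, show p - 1 - 1 ≠ p by omega]
        · simp [rowOf, h0, h1, h2, show i ≠ p - 1 by omega,
            show i - (p - 1) - 1 = i - p by omega]
  · refine ⟨p + 1, fun i => ?_⟩
    simp only [nextCell, nextSymbol, leavingState, stayingState, headAction_rowOf, hs]
    rcases eq_or_ne i p with rfl | h0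
    · simp [rowOf]
    · by_cases h1 : i - 1 = p
      · simp [rowOf, hr, show i = p + 1 by omega]
      · by_cases h2 : i + 1 = p
        · simp [rowOf, h0, h1, h2, show i ≠ p + 1 by omega,
            show i - (p + 1) + 1 = i - p by omega]
        · simp [rowOf, h0, h1, h2, show i ≠ p + 1 by omega,
            show i - (p + 1) + 1 = i - p by omega]
  · refine ⟨p, fun i => ?_⟩
    simp only [nextCell, nextSymbol, leavingState, stayingState, headAction_rowOf, hs]
    rcases eq_or_ne i p with rfl | h0
    · simp [rowOf, hw]
    · by_cases h1 : i - 1 = p <;> by_cases h2 : i + 1 = p <;>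
        simp [rowOf, h0, h1, h2, sub_eq_zero]

/-- A cell of a space-time diagram: either void, or a cell of the tape with an optional mark, saying
that all cells to the left (`false`) or to the right (`true`) are blank. -/
abbrev DiagramCell (Γ Λ : Type) : Type := Option ((Γ × Option Λ) × Option Bool)

/-- The local rule of space-time diagrams, for three consecutive cells `l`, `c`, `r` of a row and the
cell `u` above `c`. It cannot be met if the head halts at `c`. -/
def DiagramRule (M : TM0.Machine Γ Λ) (l c r u : DiagramCell Γ Λ) : Prop :=
  (∀ s, c = some (s, some false) → l = some ((default, none), some false)) ∧
  (∀ s, c = some (s, some true) → r = some ((default, none), some true)) ∧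
  ∀ a b e m₁ m₂ m₃, l = some (a, m₁) → c = some (b, m₂) → r = some (e, m₃) →
    (b.2 ≠ none → headAction M b ≠ none) ∧ u = some (nextCell M a b e, none)

/-- The marks of the initial row, for an input of length `n + 1`. -/
def initialMark (n : ℕ) (i : ℤ) : Option Bool :=
  if i ≤ 0 then some false else if n < i then some true else none

/-- The initial row, from the first cell of the input to the first blank cell. -/
def initialWord (Λ : Type) [Inhabited Λ] (a₀ : Γ) (K : List Γ) : List (DiagramCell Γ Λ) :=
  some ((a₀, some default), some false) ::
    (K.map (fun a => some ((a, none), none)) ++ [some ((default, none), some true)])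

theorem rowOf_init_of_neg (l : List Γ) {i : ℤ} (hi : i < 0) :
    rowOf 0 (TM0.init l : TM0.Cfg Γ Λ) i = (default, none) := by
  obtain ⟨n, rfl⟩ := Int.eq_negSucc_of_lt_zero hi
  have : (Tape.mk₁ l).nth (Int.negSucc n) = default := by
    change (ListBlank.mk []).nth n = default
    simp [ListBlank.nth_mk]
  simp [rowOf, TM0.init, this]

theorem rowOf_init_natCast (l : List Γ) (n : ℕ) :
    rowOf 0 (TM0.init l : TM0.Cfg Γ Λ) n = (l.getI n, if n = 0 then some default else none) := by
  have : (Tape.mk₁ l).nth n = l.getI n := by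
    simp [Tape.mk₁, Tape.mk₂]
  simp [rowOf, TM0.init, this]

theorem rowOf_init_of_gt (a₀ : Γ) (K : List Γ) {i : ℤ} (hi : K.length < i) :
    rowOf 0 (TM0.init (a₀ :: K) : TM0.Cfg Γ Λ) i = (default, none) := by
  obtain ⟨n, rfl⟩ := Int.eq_ofNat_of_zero_le (show 0 ≤ i by omega)
  rw [rowOf_init_natCast, List.getI_eq_default _ (by simp; omega), if_neg (by omega)]

theorem length_initialWord (a₀ : Γ) (K : List Γ) :
    (initialWord Λ a₀ K).length = K.length + 2 := by simp [initialWord]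

theorem initialWord_getElem (a₀ : Γ) (K : List Γ) (n : ℕ) (hn : n < (initialWord Λ a₀ K).length) :
    (initialWord Λ a₀ K)[n] = some (rowOf 0 (TM0.init (a₀ :: K)) n, initialMark K.length n) := by
  rw [rowOf_init_natCast]
  have hl := length_initialWord (Λ := Λ) a₀ K
  rcases n with _ | n
  · simp [initialWord, initialMark]
  · have h0 : ¬ ((n + 1 : ℕ) : ℤ) ≤ 0 := by omega
    rcases lt_or_ge n K.length with h | h
    · rw [initialMark, if_neg h0, if_neg (by omega)]
      simp [initialWord, h, List.getI_eq_getElem]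
    · have : n = K.length := by omega
      subst this
      have hm : initialMark K.length (K.length + 1 : ℕ) = some true := by
        rw [initialMark, if_neg h0, if_pos (by omega)]
      rw [hm]
      simp [initialWord, List.getI_eq_default]

/-- The initial row of a space-time diagram is determined by the initial word. -/
theorem eq_initial_row {M : TM0.Machine Γ Λ} {z : ℤ → DiagramCell Γ Λ}
    (hz : ∀ i, ∃ u, DiagramRule M (z i) (z (i + 1)) (z (i + 2)) u) {a₀ : Γ} {K : List Γ}
    (h : ∀ (n : ℕ) (hn : n < (initialWord Λ a₀ K).length), z n = (initialWord Λ a₀ K)[n]) (i : ℤ) :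
    z i = some (rowOf 0 (TM0.init (a₀ :: K)) i, initialMark K.length i) := by
  have hw (n : ℕ) (hn : n < K.length + 2) :
      z n = some (rowOf 0 (TM0.init (a₀ :: K)) n, initialMark K.length n) := by
    rw [h n (by rwa [length_initialWord]), initialWord_getElem]
  rcases lt_or_ge i 0 with hi | hi
  · obtain ⟨n, rfl⟩ := Int.eq_negSucc_of_lt_zero hi
    -- The `false` mark of cell `0` spreads leftwards, carrying blanks with it.
    have hl : ∀ n : ℕ, ∃ s, z (-n) = some (s, some false) ∧
        z (-n - 1) = some ((default, none), some false) := by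
      intro n
      induction n with
      | zero =>
        have h0 : z (-1 + 1) = _ := hw 0 (by omega)
        exact ⟨_, h0, ((hz (-1)).choose_spec.1 _ h0)⟩
      | succ n ih =>
        obtain ⟨s, -, h2⟩ := ih
        obtain ⟨u, hu, -⟩ := hz (-n - 1 - 1)
        rw [show (-((n + 1 : ℕ) : ℤ)) = -n - 1 by push_cast; ring]
        exact ⟨_, h2, hu _ (by rwa [sub_add_cancel])⟩
    obtain ⟨s, -, h2⟩ := hl n
    rw [rowOf_init_of_neg _ hi, initialMark, if_pos hi.le, ← h2]
    congr 1
    omega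
  · obtain ⟨n, rfl⟩ := Int.eq_ofNat_of_zero_le hi
    rcases lt_or_ge n (K.length + 1) with hn | hn
    · exact hw n (by omega)
    -- The `true` mark on the last cell of the word, `K.length + 1`, spreads rightwards in the same
    -- way.
    · obtain ⟨j, rfl⟩ := Nat.exists_eq_add_of_le hn
      rw [rowOf_init_of_gt _ _ (by omega), initialMark, if_neg (by omega), if_pos (by omega)]
      clear hi hn
      induction j with
      | zero =>
        refine (hw (K.length + 1) (by omega)).trans ?_
        rw [rowOf_init_of_gt _ _ (by omega), initialMark, if_neg (by omega), if_pos (by omega)]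
      | succ j ih =>
        obtain ⟨u, -, hu, -⟩ := hz (K.length + j)
        have := hu (default, none) (by rw [← ih]; congr 1; omega)
        rw [← this]; congr 1; omega

/-- The rows from time `0` on reproduce the run, so a halting configuration would appear as a row,
and the rule fails at its head. -/
theorem not_dom_of_diagramRule {M : TM0.Machine Γ Λ} {z : ℤ → ℤ → DiagramCell Γ Λ}
    (hz : ∀ i t, DiagramRule M (z i t) (z (i + 1) t) (z (i + 2) t) (z (i + 1) (t + 1)))
    {a₀ : Γ} {K : List Γ}
    (h : ∀ (n : ℕ) (hn : n < (initialWord Λ a₀ K).length), z n 0 = (initialWord Λ a₀ K)[n]) :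
    ¬ (TM0.eval M (a₀ :: K)).Dom := by
  intro hd
  obtain ⟨c, hc⟩ := Part.dom_iff_mem.1 (show (StateTransition.eval (TM0.step M)
    (TM0.init (a₀ :: K))).Dom from hd)
  obtain ⟨hr, hh⟩ := StateTransition.mem_eval.1 hc
  have key : ∃ t p, ∀ i, ∃ m, z i t = some (rowOf p c i, m) := by
    clear hh hc
    induction hr with
    | refl => exact ⟨0, 0, fun i => ⟨_, eq_initial_row (z := fun i => z i 0) (fun i => ⟨_, hz i 0⟩) h i⟩⟩
    | tail _ hs ih =>
      obtain ⟨t, p, hp⟩ := ih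
      obtain ⟨p', hp'⟩ := exists_rowOf_eq_nextCell hs p
      refine ⟨t + 1, p', fun i => ⟨none, ?_⟩⟩
      obtain ⟨m₁, h₁⟩ := hp (i - 1)
      obtain ⟨m₂, h₂⟩ := hp i
      obtain ⟨m₃, h₃⟩ := hp (i + 1)
      have := (hz (i - 1) t).2.2 _ _ _ m₁ m₂ m₃ h₁ (by rwa [sub_add_cancel])
        (by rw [← h₃]; congr 1; omega)
      rw [hp' i, ← this.2, sub_add_cancel]
  obtain ⟨t, p, hp⟩ := key
  obtain ⟨m₁, h₁⟩ := hp (p - 1)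
  obtain ⟨m₂, h₂⟩ := hp p
  obtain ⟨m₃, h₃⟩ := hp (p + 1)
  have := ((hz (p - 1) t).2.2 _ _ _ m₁ m₂ m₃ h₁ (by rwa [sub_add_cancel])
    (by rw [← h₃]; congr 1; omega)).1
  rw [headAction_rowOf, if_pos rfl] at this
  exact this (by simp [rowOf]) (Option.map_eq_none_iff.1 hh)

/-- The infinite run fills the rows `t ≥ 0`, and void cells fill the rows `t < 0`. Void cells
constrain nothing above them, so row `0` is free to be the initial one. -/
theorem exists_diagram_of_not_dom {M : TM0.Machine Γ Λ} {a₀ : Γ} {K : List Γ}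
    (hd : ¬ (TM0.eval M (a₀ :: K)).Dom) : ∃ z : ℤ → ℤ → DiagramCell Γ Λ,
      (∀ i t, DiagramRule M (z i t) (z (i + 1) t) (z (i + 2) t) (z (i + 1) (t + 1))) ∧
      ∀ (n : ℕ) (hn : n < (initialWord Λ a₀ K).length), z n 0 = (initialWord Λ a₀ K)[n] := by
  have hs : ∀ c, StateTransition.Reaches (TM0.step M) (TM0.init (a₀ :: K)) c →
      ∃ c', c' ∈ TM0.step M c := by
    intro c hc
    by_contra! h
    have hn : TM0.step M c = none := Option.eq_none_iff_forall_not_mem.2 h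
    exact hd (show (StateTransition.eval (TM0.step M) (TM0.init (a₀ :: K))).Dom from
      Part.dom_iff_mem.2 ⟨c, StateTransition.mem_eval.2 ⟨hc, hn⟩⟩)
  -- On reachable configurations a next step always exists, so it can be chosen and iterated.
  let R := {c : TM0.Cfg Γ Λ // StateTransition.Reaches (TM0.step M) (TM0.init (a₀ :: K)) c}
  have hnext : ∀ s : ℤ × R, ∃ s' : ℤ × R, ∀ i, rowOf s'.1 s'.2.1 i =
      nextCell M (rowOf s.1 s.2.1 (i - 1)) (rowOf s.1 s.2.1 i) (rowOf s.1 s.2.1 (i + 1)) := by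
    rintro ⟨p, c, hc⟩
    obtain ⟨c', hc'⟩ := hs c hc
    obtain ⟨p', hp'⟩ := exists_rowOf_eq_nextCell hc' p
    exact ⟨(p', ⟨c', hc.tail hc'⟩), hp'⟩
  choose F hF using hnext
  let s (t : ℕ) : ℤ × R := F^[t] (0, ⟨TM0.init (a₀ :: K), .refl⟩)
  have hsucc (t : ℕ) : s (t + 1) = F (s t) := Function.iterate_succ_apply' _ _ _
  let mark (t : ℕ) (i : ℤ) : Option Bool := if t = 0 then initialMark K.length i else none
  let z (i t : ℤ) : DiagramCell Γ Λ := match t with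
    | Int.ofNat t => some (rowOf (s t).1 (s t).2.1 i, mark t i)
    | Int.negSucc _ => none
  have hstep : ∀ (t : ℕ) (i : ℤ), rowOf (s (t + 1)).1 (s (t + 1)).2.1 (i + 1) =
      nextCell M (rowOf (s t).1 (s t).2.1 i) (rowOf (s t).1 (s t).2.1 (i + 1))
        (rowOf (s t).1 (s t).2.1 (i + 2)) := by
    intro t i
    have := hF (s t) (i + 1)
    rwa [hsucc, ← show i + 1 + 1 = i + 2 by ring, ← add_sub_cancel_right i 1, sub_add_cancel]
  refine ⟨z, ?_, fun n hn => (initialWord_getElem a₀ K n hn).symm⟩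
  rintro i (t | t)
  · refine ⟨?_, ?_, ?_⟩
    -- Marks occur only in row `0`, where a `false` mark at `i + 1` means `i + 1 ≤ 0`.
    · intro r hr
      obtain ⟨-, hm⟩ := Prod.ext_iff.1 (Option.some.inj hr)
      rcases t with _ | t
      · have hi : i < 0 := by
          by_contra hi
          simp only [mark, initialMark, if_pos, if_neg (show ¬ i + 1 ≤ 0 by omega)] at hm
          split_ifs at hm; simp at hm
        change some (rowOf 0 (TM0.init (a₀ :: K)) i, initialMark K.length i) = _
        rw [rowOf_init_of_neg _ hi, initialMark, if_pos hi.le]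
      · simp [mark] at hm
    · intro r hr
      obtain ⟨-, hm⟩ := Prod.ext_iff.1 (Option.some.inj hr)
      rcases t with _ | t
      · have hi : K.length < i + 1 := by
          by_contra hi
          simp only [mark, initialMark, if_pos, if_neg hi] at hm
          split_ifs at hm; simp at hm
        change some (rowOf 0 (TM0.init (a₀ :: K)) (i + 2), initialMark K.length (i + 2)) = _
        rw [rowOf_init_of_gt _ _ (by omega), initialMark, if_neg (by omega), if_pos (by omega)]
      · simp [mark] at hm
    · intro a b e m₁ m₂ m₃ h₁ h₂ h₃
      obtain ⟨rfl, -⟩ := Prod.ext_iff.1 (Option.some.inj h₁)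
      obtain ⟨rfl, -⟩ := Prod.ext_iff.1 (Option.some.inj h₂)
      obtain ⟨rfl, -⟩ := Prod.ext_iff.1 (Option.some.inj h₃)
      constructor
      · intro hb
        rw [headAction_rowOf]
        have hp : i + 1 = (s t).1 := by
          by_contra hp
          exact hb (by simp [rowOf, hp])
        rw [if_pos hp]
        intro hM
        obtain ⟨c', hc'⟩ := hs _ (s t).2.2
        have : TM0.step M (s t).2.1 = none := Option.map_eq_none_iff.2 hM
        rw [this] at hc'
        cases hc'
      · rw [← hstep]
        rfl
  · refine ⟨?_, ?_, ?_⟩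
    · intro r hr; cases hr
    · intro r hr; cases hr
    · intro a b e m₁ m₂ m₃ h₁; cases h₁

end SpaceTime

/-! ### The inclusion problem for a universal rule shift is `Π⁰₂`-hard -/

/-- The pattern showing the word `w` from the origin on in direction `k`. -/
def rowPattern {d : ℕ} (k : Fin d) (w : List ℕ) : List (Grid d × ℕ) :=
  (List.range w.length).map fun j : ℕ => (Pi.single k (j : ℤ), w.getD j 0)

theorem Primrec.rowPattern {d : ℕ} (k : Fin d) : Primrec (rowPattern k) :=
  Primrec.list_map (Primrec.list_range.comp Primrec.list_length)
    (((Primrec.natCast_mul_unitVec k).comp Primrec.snd).pair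
      ((Primrec.list_getD 0).comp Primrec.fst Primrec.snd)).to₂

theorem lookup_map_of_injective {α β γ : Type*} [BEq β] [LawfulBEq β] {g : α → β}
    (hg : Function.Injective g) (h : α → γ) {L : List α} {a : α} (ha : a ∈ L) :
    (L.map fun j => (g j, h j)).lookup (g a) = some (h a) := by
  induction L with
  | nil => cases ha
  | cons b L ih =>
    by_cases hab : a = b
    · subst hab; simp
    · have : (g a == g b) = false := by simpa using fun h => hab (hg h)
      simpa [List.lookup_cons, this] using ih ((List.mem_cons.1 ha).resolve_left hab)

theorem shows_rowPattern_iff {d : ℕ} (k : Fin d) (w : List ℕ) (x : Grid d → ℕ) :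
    (∀ p ∈ rowPattern k w, some (x p.1) = (rowPattern k w).lookup p.1) ↔
      ∀ (n : ℕ) (hn : n < w.length), x (Pi.single k (n : ℤ)) = w[n] := by
  have hg : Function.Injective fun j : ℕ => (Pi.single k (j : ℤ) : Grid d) :=
    (Pi.single_injective (M := fun _ => ℤ) k).comp Nat.cast_injective
  have h (n : ℕ) (hn : n < w.length) :
      (rowPattern k w).lookup (Pi.single k (n : ℤ)) = some w[n] := by
    rw [rowPattern, lookup_map_of_injective hg (fun j => w.getD j 0) (List.mem_range.2 hn),
      List.getD_eq_getElem _ _ hn]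
  constructor
  · intro H n hn
    have := H (Pi.single k (n : ℤ), w.getD n 0) (List.mem_map.2 ⟨n, List.mem_range.2 hn, rfl⟩)
    rw [h n hn] at this
    exact Option.some.inj this
  · intro H p hp
    obtain ⟨n, hn, rfl⟩ := List.mem_map.1 hp
    rw [List.mem_range] at hn
    rw [h n hn, H n hn]

/-- For every partial recursive function there are a rule shift and a primitive recursive sequence
of patterns, such that the `n`-th pattern appears if and only if the function is not defined
at `n`. -/
theorem exists_ruleShift_of_partrec {d : ℕ} {k k' : Fin d} (hk : k ≠ k') {f : ℕ →. ℕ}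
    (hf : Partrec f) :
    ∃ (N : ℕ) (ok : Fin N → Fin N → Fin N → Fin N → Prop) (P : ℕ → List (Grid d × ℕ)),
      Primrec P ∧ ∀ n, (f n).Dom ↔ ∀ y ∈ (ruleShift k k' ok).carrier,
        ¬ ∀ p ∈ P n, some (y p.1) = (P n).lookup p.1 := by
  obtain ⟨Γ, Λ, iΓ, iΛ, fΓ, fΛ, M, a₀, K, hK, hM⟩ := exists_tm0_of_partrec hf
  obtain ⟨N, ⟨e⟩⟩ := Finite.exists_equiv_fin (DiagramCell Γ Λ)
  let ok (a b c u : Fin N) : Prop := DiagramRule M (e.symm a) (e.symm b) (e.symm c) (e.symm u)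
  let w (n : ℕ) : List ℕ := (initialWord Λ a₀ (K n)).map fun c => (e c : ℕ)
  refine ⟨N, ok, fun n => rowPattern k (w n), (Primrec.rowPattern k).comp ?_, fun n => ?_⟩
  · have h := Primrec.list_map (hK N fun a => e (some ((a, none), none)))
      (Primrec.fin_val.comp Primrec.snd).to₂
    refine (Primrec.list_cons.comp (Primrec.const (e (some ((a₀, some default), some false)) : ℕ))
      (Primrec.list_append.comp h
        (Primrec.const [(e (some ((default, none), some true)) : ℕ)]))).of_eq fun n => ?_
    simp [w, initialWord]
  · have hw (n m : ℕ) (hm : m < (initialWord Λ a₀ (K n)).length) :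
        (w n)[m]'(by simpa [w] using hm) = e (initialWord Λ a₀ (K n))[m] := by
      simp [w]
    rw [← hM]
    constructor
    · intro hd x hx hp
      obtain ⟨y, hxy, hy⟩ := (mem_ruleShift hk).1 hx
      rw [shows_rowPattern_iff] at hp
      -- The diagram is read off on the plane through the origin spanned by the directions `k` and
      -- `k'`.
      refine not_dom_of_diagramRule (M := M)
        (z := fun i t => e.symm (y (Pi.single k i + Pi.single k' t))) (fun i t => ?_) (fun m hm => ?_) hd
      · have h := hy (Pi.single k i + Pi.single k' t)
        have h1 : (Pi.single k i + Pi.single k' t + unitVec k : Grid d) =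
            Pi.single k (i + 1) + Pi.single k' t := by
          rw [unitVec, Pi.single_add, add_right_comm]
        have h2 : (Pi.single k (i + 1) + Pi.single k' t + unitVec k : Grid d) =
            Pi.single k (i + 2) + Pi.single k' t := by
          rw [unitVec, add_right_comm, ← Pi.single_add, add_assoc i]; rfl
        have h3 : (Pi.single k (i + 1) + Pi.single k' t + unitVec k' : Grid d) =
            Pi.single k (i + 1) + Pi.single k' (t + 1) := by
          rw [unitVec, add_assoc, ← Pi.single_add]
        rwa [h1, h2, h3] at h
      · have := hp m (by simpa [w] using hm)
        rw [hw _ _ hm, hxy, Fin.val_inj] at this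
        simp [this]
    · intro h
      by_contra hd
      obtain ⟨z, hz, hz0⟩ := exists_diagram_of_not_dom hd
      -- Conversely, a diagram is extended constantly along all other directions.
      refine h (fun u => e (z (u k) (u k'))) ((mem_ruleShift hk).2 ⟨fun u => e (z (u k) (u k')),
        fun _ => rfl, fun u => ?_⟩)
        ((shows_rowPattern_iff k (w n) fun u => (e (z (u k) (u k')) : ℕ)).2 fun m hm => ?_)
      · have h1 : (unitVec k : Grid d) k = 1 := by simp [unitVec]
        have h2 : (unitVec k' : Grid d) k' = 1 := by simp [unitVec]
        have h3 : (unitVec k : Grid d) k' = 0 := by simp [unitVec, hk.symm]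
        have h4 : (unitVec k' : Grid d) k = 0 := by simp [unitVec, hk]
        simpa [ok, h1, h2, h3, h4, add_assoc] using hz (u k) (u k')
      · have hm' : m < (initialWord Λ a₀ (K n)).length := by simpa [w] using hm
        rw [hw _ _ hm', ← hz0 m hm']
        simp [hk.symm]

/-- The universal partial recursive function. -/
def universalFun (n : ℕ) : Part ℕ :=
  (Denumerable.ofNat Nat.Partrec.Code n.unpair.1).eval n.unpair.2

theorem partrec_universalFun : Partrec universalFun :=
  Nat.Partrec.Code.eval_part.comp
    ((Primrec.ofNat _).to_comp.comp (Computable.fst.comp Computable.unpair))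
    (Computable.snd.comp Computable.unpair)

theorem universalFun_pair (c : Nat.Partrec.Code) (n : ℕ) :
    universalFun (Nat.pair (Encodable.encode c) n) = c.eval n := by
  simp [universalFun]

theorem exists_code_dom_iff_exists {p : ℕ → ℕ → Bool} (hp : Computable₂ p) :
    ∃ c : Nat.Partrec.Code, ∀ a, (c.eval a).Dom ↔ ∃ n, p a n = true := by
  obtain ⟨c, hc⟩ := Nat.Partrec.Code.exists_code.1 (Partrec.nat_iff.1 (Partrec.rfind hp.partrec₂))
  refine ⟨c, fun a => ?_⟩
  rw [hc]
  exact Nat.rfind_dom.trans ⟨fun ⟨n, h, _⟩ => ⟨n, (Part.mem_some_iff.1 h).symm⟩,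
    fun ⟨n, h⟩ => ⟨n, Part.mem_some_iff.2 h.symm, fun _ => trivial⟩⟩

/-- The inner existential quantifier becomes the halting of an unbounded search. -/
theorem IsPi02.exists_code {Q : ℕ → Prop} (hQ : IsPi02 Q) :
    ∃ c : Nat.Partrec.Code, ∀ a, Q a ↔ ∀ m, (c.eval (Nat.pair a m)).Dom := by
  obtain ⟨R, ⟨_, hR⟩, h⟩ := hQ
  obtain ⟨c, hc⟩ := exists_code_dom_iff_exists
    (p := fun p n => decide (R (p.unpair.1, p.unpair.2, n))) (hR.comp
      ((Computable.fst.comp (Computable.unpair.comp Computable.fst)).pair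
        ((Computable.snd.comp (Computable.unpair.comp Computable.fst)).pair Computable.snd)))
  exact ⟨c, fun a => (h a).trans (forall_congr' fun m => by simp [hc])⟩

theorem isPi02Hard_subset_effectiveSubshift {d : ℕ} {k k' : Fin d} {N : ℕ}
    {ok : Fin N → Fin N → Fin N → Fin N → Prop} {P : ℕ → List (Grid d × ℕ)} (hP : Primrec P)
    (h : ∀ n, (universalFun n).Dom ↔ ∀ y ∈ (ruleShift k k' ok).carrier,
        ¬ ∀ p ∈ P n, some (y p.1) = (P n).lookup p.1) :
    IsPi02Hard fun i : List ℕ × Nat.Partrec.Code =>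
      (ruleShift k k' ok).carrier ⊆ (effectiveSubshift d i).carrier := by
  intro Q hQ
  obtain ⟨c, hc⟩ := hQ.exists_code
  let code (l : List (Grid d × ℕ)) : ℕ := @Encodable.encode _ Primcodable.toEncodable l
  let P' (a m : ℕ) : List (Grid d × ℕ) := P (Nat.pair (Encodable.encode c) (Nat.pair a m))
  have h1 : Primrec fun r : ℕ × ℕ => P' r.1.unpair.1 r.2 :=
    hP.comp (Primrec₂.natPair.comp (Primrec.const _) (Primrec₂.natPair.comp
      (Primrec.fst.comp (Primrec.unpair.comp Primrec.fst)) Primrec.snd))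
  -- On `(a, l)` this program searches for an `m` with `P' a m = l`; fixing `a` by currying gives
  -- the program of the reduction.
  obtain ⟨s, hs⟩ := exists_code_dom_iff_exists
    (p := fun q m => decide (code (P' q.unpair.1 m) = q.unpair.2))
    (Primrec.eq.comp (Primrec.encode.comp h1)
      (Primrec.snd.comp (Primrec.unpair.comp Primrec.fst))).decide.to_comp
  -- The alphabet is that of `Y`, so the inclusion depends on the forbidden patterns alone.
  refine ⟨fun a => (List.range N, s.curry a), ((Primrec.const _).pair
    (Nat.Partrec.Code.primrec₂_curry.comp (Primrec.const s) Primrec.id)).to_comp, fun a => ?_⟩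
  have hdom (l : List (Grid d × ℕ)) : ((s.curry a).eval (code l)).Dom ↔ ∃ m, P' a m = l := by
    rw [Nat.Partrec.Code.eval_curry, hs]
    simp [code, (@Encodable.encode_injective _ Primcodable.toEncodable).eq_iff]
  rw [hc]
  refine Iff.trans ?_ (subset_effectiveSubshift_iff _ _).symm
  constructor
  · intro H
    refine ⟨fun y hy u => List.mem_range.2 (Finset.mem_range.1 (hy.1 u)), fun l hl => ?_⟩
    obtain ⟨m, rfl⟩ := (hdom l).1 hl
    exact (h _).1 (by rw [universalFun_pair]; exact H m)
  · intro H m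
    rw [← universalFun_pair]
    exact (h _).2 (H.2 _ ((hdom _).2 ⟨m, rfl⟩))

theorem mainTheorem3 (d : ℕ) (hd : 2 ≤ d) :
    ∃ Y : Subshift ℕ (Grid d), IsSFT Y ∧
      IsPi02Complete (fun i : List ℕ × Nat.Partrec.Code =>
        Y.carrier ⊆ (effectiveSubshift d i).carrier) := by
  have hk : (⟨0, by omega⟩ : Fin d) ≠ ⟨1, by omega⟩ := by simp
  obtain ⟨N, ok, P, hP, h⟩ := exists_ruleShift_of_partrec hk partrec_universalFun
  exact ⟨_, isSFT_ruleShift _ _ ok, isPi02_subset_effectiveSubshift hk ok,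
    isPi02Hard_subset_effectiveSubshift hP h⟩
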